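/- Fix a pattern $\sigma$. A word contains $\sigma$ if it has a (not necessarily contiguous) subword order isomorphic to $\sigma$. The $\sigma$-machine processes a permutation $\pi=\pi_1\pi_2\cdots\pi_n$, scanned from left to right, with two initially empty stacks in series, $\mathrm{Stack}_\sigma$ followed by $\mathrm{Stack}_I$, as follows. While there is an unscanned letter, let $a$ be the next one. If $\mathrm{Stack}_\sigma$ with $a$ placed on top, read from top to bottom, does not contain $\sigma$, then push $a$ onto $\mathrm{Stack}_\sigma$. Otherwise, if $\mathrm{Stack}_I$ is empty or the top of $\mathrm{Stack}_\sigma$ is smaller than the top of $\mathrm{Stack}_I$, move the top of $\mathrm{Stack}_\sigma$ onto $\mathrm{Stack}_I$; otherwise move the top of $\mathrm{Stack}_I$ to the end of the output. When the input is exhausted, continue with the last two rules until $\mathrm{Stack}_\sigma$ is empty, and then empty $\mathrm{Stack}_I$, from the top, into the output. Let $\mathrm{Sort}_n(\sigma)$ be the set of permutations of length $n$ for which the output is $12\cdots n$. Then, for all $n\ge 1$, $$|\mathrm{Sort}_n(123)| = 1+\sum_{h=1}^{n-1}(n-h)\,C_h,$$ where $C_h=\frac{1}{h+1}\binom{2h}{h}$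 is the $h$-th Catalan number. -/

import Mathlib

namespace SigmaMachine

/-- The word `w` contains the pattern `σ`: some subword of `w` (in the positions `f 0 < f 1 < …`)
is order isomorphic to `σ`. -/
def Contains (σ w : List ℕ) : Prop :=
  ∃ f : Fin σ.length → Fin w.length, StrictMono f ∧
    ∀ i j, w.get (f i) < w.get (f j) ↔ σ.get i < σ.get j

instance (σ w : List ℕ) : Decidable (Contains σ w) := by
  unfold Contains StrictMono
  infer_instance

/-- A configuration of the machine. The `input` is what remains to be scanned, both stacks are
listed from top to bottom, and the `output` is listed from left to right. -/
structure State where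
  input : List ℕ
  stackSigma : List ℕ
  stackI : List ℕ
  output : List ℕ

/-- The operation `S_σ`, `S_I` or `O` that the machine performs next, applied to the configuration;
`none` if the machine has stopped. The next element of the input enters the `σ`-avoiding stack
whenever this does not create an occurrence of `σ` there (read from top to bottom). Otherwise,
and also when the input is exhausted, the top of the `σ`-avoiding stack enters the increasing stack
if the latter is empty or has a larger top, and if not the top of the increasing stack is output.
When only the increasing stack is left, it is emptied into the output. -/
def step (σ : List ℕ) : State → Option State
  | ⟨a :: w, S, I, out⟩ =>
      if ¬ Contains σ (a :: S) then some ⟨w, a :: S, I, out⟩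
      else match S, I with
        | t :: S', [] => some ⟨a :: w, S', [t], out⟩
        | t :: S', u :: I' =>
            if t < u then some ⟨a :: w, S', t :: u :: I', out⟩
            else some ⟨a :: w, t :: S', I', out ++ [u]⟩
        | [], _ => none  -- unreachable when `σ` has at least two letters
  | ⟨[], t :: S', [], out⟩ => some ⟨[], S', [t], out⟩
  | ⟨[], t :: S', u :: I', out⟩ =>
      if t < u then some ⟨[], S', t :: u :: I', out⟩
      else some ⟨[], t :: S', I', out ++ [u]⟩
  | ⟨[], [], u :: I', out⟩ => some ⟨[], [], I', out ++ [u]⟩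
  | ⟨[], [], [], _⟩ => none

/-- The number of operations that remain to be performed. -/
def State.size (s : State) : ℕ :=
  3 * s.input.length + 2 * s.stackSigma.length + s.stackI.length

theorem step_size {σ : List ℕ} {s s' : State} (h : step σ s = some s') : s'.size < s.size := by
  unfold step at h
  split at h
  · split_ifs at h
    · split at h
      · cases h; simp [State.size]; omega
      · split_ifs at h <;> cases h <;> simp [State.size] <;> omega
      · cases h
    · cases h; simp [State.size]; omega
  · cases h; simp [State.size]; omega
  · split_ifs at h <;> cases h <;> simp [State.size] <;> omega
  · cases h; simp [State.size]
  · cases h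

/-- Run the machine from the configuration `s` until it stops, and return the output. -/
def run (σ : List ℕ) (s : State) : List ℕ :=
  match _h : step σ s with
  | none => s.output
  | some s' => run σ s'
termination_by s.size
decreasing_by exact step_size _h

/-- The output of the `σ`-machine on the input word `w`, started with both stacks empty. -/
def machine (σ w : List ℕ) : List ℕ := run σ ⟨w, [], [], []⟩

/-- The one-line notation `π₁ π₂ ⋯ πₙ` of a permutation of length `n`, with letters `1, …, n`. -/
def word {n : ℕ} (π : Equiv.Perm (Fin n)) : List ℕ := List.ofFn fun i => (π i : ℕ) + 1

/-- The set of the permutations of length `n` that the `σ`-machine sorts, i.e. for which it outputs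
`1 2 ⋯ n`. -/
def SortSet (n : ℕ) (σ : List ℕ) : Set (Equiv.Perm (Fin n)) :=
  {π | machine σ (word π) = List.range' 1 n}

end SigmaMachine

/-! Whether a letter enters the first stack depends only on that stack, so the machine is the
composition of two passes (`run_eq_append_increasingPass`). The second pass sorts exactly the words
avoiding 231 (`pairwise_increasingPass_iff`), and the question becomes when `sigmaPass w []` avoids
231.

The first letter k stays at the bottom of the first stack until the input is exhausted. If b < k
lies in the stack and some a < b arrives, then b and k block a, so b has to leave; a later letter
above b would leave before some letter below b and complete a 231. Hence no letter below k is the 2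
of a 213. Moreover, the letters above k arrive in increasing order and before anything is popped,
around one increasing run A of letters below k (`exists_isSortedTail`). Conversely, every word k L₁
A L₂ R of this form leaves the first stack as two decreasing sequences that contain no 231
(`avoids231_sigmaPass_of_isSortedTail`).

Let k = h + 1. The small letters form an arbitrary 213-avoiding word of length h, which binary trees
count by `catalan h`; A is its first run and R the rest. The n - 1 - h large letters, in increasing
order, are cut into L₁ and L₂ in n - h ways. For h = 0 the cut is invisible and only the identity
arises: this is the summand 1. -/

namespace SigmaMachine

/-! ### Pattern avoidance as a condition on triples -/

/-- No subword `x y z` of the list is order isomorphic to `123`. -/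
abbrev Avoids123 (l : List ℕ) : Prop := l.Triplewise fun x y z => ¬(x < y ∧ y < z)

/-- No subword `x y z` of the list is order isomorphic to `231`. -/
abbrev Avoids231 (l : List ℕ) : Prop := l.Triplewise fun x y z => ¬(z < x ∧ x < y)

/-- No subword `x y z` of the list is order isomorphic to `213`. -/
abbrev Avoids213 (l : List ℕ) : Prop := l.Triplewise fun x y z => ¬(y < x ∧ x < z)

theorem triplewise_of_append_right {p : ℕ → ℕ → ℕ → Prop} {l₁ l₂ : List ℕ}
    (h : (l₁ ++ l₂).Triplewise p) : l₂.Triplewise p :=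
  (List.triplewise_append.1 h).2.1

theorem triplewise_of_sublist {p : ℕ → ℕ → ℕ → Prop} {l₁ l₂ : List ℕ}
    (h : l₁.Sublist l₂) (h₂ : l₂.Triplewise p) : l₁.Triplewise p := by
  induction h with
  | slnil => exact h₂
  | cons a _ ih => exact ih (List.triplewise_cons.1 h₂).2
  | cons_cons a hs ih =>
    rw [List.triplewise_cons] at h₂ ⊢
    exact ⟨h₂.1.sublist hs, ih h₂.2⟩

theorem contains_iff_not_avoids123 (w : List ℕ) : Contains [1, 2, 3] w ↔ ¬ Avoids123 w := by
  rw [Avoids123, List.triplewise_iff_getElem]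
  push Not
  constructor
  · rintro ⟨f, hf, h⟩
    refine ⟨f 0, f 1, f 2, hf (by decide), hf (by decide), (f 2).2, ?_, ?_⟩
    · exact (h 0 1).2 (by decide)
    · exact (h 1 2).2 (by decide)
  · rintro ⟨i, j, k, hij, hjk, hk, h₁, h₂⟩
    refine ⟨![⟨i, by omega⟩, ⟨j, by omega⟩, ⟨k, hk⟩], ?_, ?_⟩
    · intro a b hab
      fin_cases a <;> fin_cases b <;> simp_all
      omega
    · intro a b
      fin_cases a <;> fin_cases b <;> simp_all <;> omega

/-! ### Decoupling the two stacks -/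

/-- The word that leaves the `123`-avoiding stack when the word `w` is still to be read and the
stack holds `S`, listed from top to bottom. -/
def sigmaPass : List ℕ → List ℕ → List ℕ
  | [], S => S
  | a :: w, [] => sigmaPass w [a]
  | a :: w, t :: S =>
      if Contains [1, 2, 3] (a :: t :: S) then t :: sigmaPass (a :: w) S
      else sigmaPass w (a :: t :: S)
termination_by w S => 2 * w.length + S.length
decreasing_by all_goals (simp; try omega)

theorem sigmaPass_nil (S : List ℕ) : sigmaPass [] S = S := by
  rw [sigmaPass]

theorem sigmaPass_push {a : ℕ} {w S : List ℕ} (h : Avoids123 (a :: S)) :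
    sigmaPass (a :: w) S = sigmaPass w (a :: S) := by
  cases S with
  | nil => rw [sigmaPass]
  | cons t S => rw [sigmaPass, if_neg (by simpa [contains_iff_not_avoids123] using h)]

theorem sigmaPass_pop {a t : ℕ} {w S : List ℕ} (h : ¬ Avoids123 (a :: t :: S)) :
    sigmaPass (a :: w) (t :: S) = t :: sigmaPass (a :: w) S := by
  rw [sigmaPass, if_pos ((contains_iff_not_avoids123 _).2 h)]

/-- The word that leaves the increasing stack when the word `l` is still to be read and the
stack holds `I`, listed from top to bottom. -/
def increasingPass : List ℕ → List ℕ → List ℕ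
  | [], I => I
  | t :: l, [] => increasingPass l [t]
  | t :: l, u :: I =>
      if t < u then increasingPass l (t :: u :: I) else u :: increasingPass (t :: l) I
termination_by l I => 2 * l.length + I.length
decreasing_by all_goals (simp; try omega)

theorem run_of_step_eq_some {σ : List ℕ} {s s' : State} (h : step σ s = some s') :
    run σ s = run σ s' := by
  rw [run]
  split
  · simp_all
  · simp_all

theorem run_of_step_eq_none {σ : List ℕ} {s : State} (h : step σ s = none) :
    run σ s = s.output := by
  rw [run]
  split
  · rfl
  · simp_all

/-- The right-hand side is an invariant of `step`: moves of the second stack never influence what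
the first one does next, so their interleaving is irrelevant. -/
theorem run_eq_append_increasingPass (w S I out : List ℕ) :
    run [1, 2, 3] ⟨w, S, I, out⟩ = out ++ increasingPass (sigmaPass w S) I := by
  induction hN : (State.mk w S I out).size using Nat.strong_induction_on
    generalizing w S I out with
  | _ N ih =>
  subst hN
  have key : ∀ w' S' I' out', step [1, 2, 3] ⟨w, S, I, out⟩ = some ⟨w', S', I', out'⟩ →
      out' ++ increasingPass (sigmaPass w' S') I' = out ++ increasingPass (sigmaPass w S) I →
      run [1, 2, 3] ⟨w, S, I, out⟩ = out ++ increasingPass (sigmaPass w S) I := by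
    intro w' S' I' out' h h'
    rw [run_of_step_eq_some h, ih _ (step_size h) _ _ _ _ rfl, h']
  rcases w with _ | ⟨a, w⟩
  · rcases S with _ | ⟨t, S⟩
    · rcases I with _ | ⟨u, I⟩
      · rw [run_of_step_eq_none (by rfl)]
        simp [sigmaPass_nil, increasingPass]
      · exact key _ _ _ _ rfl (by simp [sigmaPass_nil, increasingPass])
    · rcases I with _ | ⟨u, I⟩
      · exact key _ _ _ _ rfl (by simp [sigmaPass_nil, increasingPass])
      · by_cases h : t < u
        · exact key [] S (t :: u :: I) out (by simp [step, h])
            (by simp [sigmaPass_nil, increasingPass, h])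
        · exact key [] (t :: S) I (out ++ [u]) (by simp [step, h])
            (by simp [sigmaPass_nil, increasingPass, h])
  · by_cases hc : Avoids123 (a :: S)
    · refine key w (a :: S) I out (if_pos ?_) (by rw [sigmaPass_push hc])
      simpa [contains_iff_not_avoids123] using hc
    · have hc' := (contains_iff_not_avoids123 _).2 hc
      rcases S with _ | ⟨t, S⟩
      · exact absurd (List.triplewise_singleton a _) hc
      · rcases I with _ | ⟨u, I⟩
        · exact key (a :: w) S [t] out (by simp [step, hc'])
            (by simp [sigmaPass_pop hc, increasingPass])
        · by_cases h : t < u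
          · exact key (a :: w) S (t :: u :: I) out (by simp [step, hc', h])
              (by simp [sigmaPass_pop hc, increasingPass, h])
          · exact key (a :: w) (t :: S) I (out ++ [u]) (by simp [step, hc', h])
              (by simp [sigmaPass_pop hc, increasingPass, h])

theorem machine_eq_increasingPass (w : List ℕ) :
    machine [1, 2, 3] w = increasingPass (sigmaPass w []) [] :=
  run_eq_append_increasingPass w [] [] []

/-! ### The second stack sorts the 231-avoiding words -/

theorem increasingPass_perm (l I : List ℕ) : (increasingPass l I).Perm (l ++ I) := by
  induction l, I using increasingPass.induct with
  | case1 I => simp [increasingPass]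
  | case2 t l ih =>
    rw [increasingPass]
    exact ih.trans (by simp)
  | case3 t l u I h ih =>
    rw [increasingPass, if_pos h]
    exact ih.trans (by simp)
  | case4 t l u I h ih =>
    rw [increasingPass, if_neg h]
    exact (ih.cons u).trans (List.perm_middle (l₁ := t :: l)).symm

theorem sigmaPass_perm (w S : List ℕ) : (sigmaPass w S).Perm (w ++ S) := by
  induction w, S using sigmaPass.induct with
  | case1 I => simp [sigmaPass]
  | case2 t l ih =>
    rw [sigmaPass]
    exact ih.trans (by simp)
  | case3 t l u I h ih =>
    rw [sigmaPass, if_pos h]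
    exact (ih.cons u).trans (List.perm_middle (l₁ := t :: l)).symm
  | case4 t l u I h ih =>
    rw [sigmaPass, if_neg h]
    exact ih.trans (by simp)

/-- A letter u is output because a larger t arrives, and this is harmful exactly if some z < u is
still to come, that is, if u t z is a 231. Reversing `I` restores the order of arrival of the
letters not yet output. -/
theorem pairwise_increasingPass_iff (l I : List ℕ) (hI : I.Pairwise (· < ·))
    (hnd : (l ++ I).Nodup) :
    (increasingPass l I).Pairwise (· < ·) ↔ Avoids231 (I.reverse ++ l) := by
  induction l, I using increasingPass.induct with
  | case1 I =>
    simp only [increasingPass, hI, List.append_nil, true_iff]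
    rw [Avoids231, List.triplewise_reverse]
    clear hnd
    induction hI with
    | nil => exact .nil
    | cons h _ ih =>
      refine .cons ?_ ih
      refine List.Pairwise.imp_of_mem (fun {x y} hx hy hxy => ?_) ‹_›
      omega
  | case2 t l ih =>
    rw [increasingPass, ih (by simp) (by
      rw [List.append_nil] at hnd
      exact (List.perm_append_comm (l₁ := l) (l₂ := [t])).nodup_iff.2 hnd)]
    simp
  | case3 t l u I h ih =>
    rw [increasingPass, if_pos h, ih]
    · simp
    · refine List.pairwise_cons.2 ⟨?_, hI⟩
      intro x hx
      rcases List.mem_cons.1 hx with rfl | hx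
      · exact h
      · exact h.trans ((List.pairwise_cons.1 hI).1 x hx)
    · exact (List.perm_middle (l₁ := l) (l₂ := u :: I)).nodup_iff.2 hnd
  | case4 t l u I h ih =>
    have hI' := List.pairwise_cons.1 hI
    have hnd' := (List.perm_middle (l₁ := t :: l) (l₂ := I)).nodup_iff.1 hnd
    have hnd'' := List.nodup_cons.1 hnd'
    rw [increasingPass, if_neg h, List.pairwise_cons, ih hI'.2 hnd''.2]
    -- The letters of `I` lie above its former top `u` anyway, so only the unread ones matter.
    have hmem : (∀ x ∈ increasingPass (t :: l) I, u < x) ↔ ∀ x ∈ t :: l, u < x := by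
      constructor
      · intro H x hx
        exact H x ((increasingPass_perm _ _).mem_iff.2 (List.mem_append_left _ hx))
      · intro H x hx
        rcases List.mem_append.1 ((increasingPass_perm _ _).mem_iff.1 hx) with hx | hx
        · exact H x hx
        · exact hI'.1 x hx
    rw [hmem]
    have hut : u < t := by
      have : u ≠ t := by rintro rfl; simp at hnd''
      omega
    unfold Avoids231
    rw [List.reverse_cons, List.append_assoc, List.triplewise_append, List.triplewise_append,
      List.singleton_append, List.triplewise_cons (a := u)]
    constructor
    · rintro ⟨H, h1, h2, h3, h4⟩
      refine ⟨h1, ⟨List.pairwise_iff_forall_sublist.2 fun {a b} hab => ?_, h2⟩, ?_, ?_⟩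
      · have := H b (hab.subset (by simp))
        omega
      · intro a ha
        refine List.pairwise_cons.2 ⟨?_, h3 a ha⟩
        intro b hb
        have := hI'.1 a (List.mem_reverse.1 ha)
        omega
      · intro a ha
        rcases List.mem_cons.1 ha with rfl | ha
        · exact List.pairwise_reverse.2 (hI'.2.imp fun h => by omega)
        · exact h4 a ha
    · rintro ⟨h1, ⟨h2, h3⟩, h4, h5⟩
      refine ⟨?_, h1, h3, fun a ha => (List.pairwise_cons.1 (h4 a ha)).2,
        fun a ha => h5 a (List.mem_cons_of_mem _ ha)⟩
      intro x hx
      rcases List.mem_cons.1 hx with rfl | hx'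
      · exact hut
      · have := (List.pairwise_cons.1 h2).1 x hx'
        have : u ≠ x := by rintro rfl; exact hnd''.1 (List.mem_append_left _ hx)
        omega

/-- A permutation of `1, …, n` is sorted if and only if the word that leaves the first stack
avoids `231`. -/
theorem machine_eq_range'_iff {n : ℕ} {w : List ℕ} (hw : w.Perm (List.range' 1 n)) :
    machine [1, 2, 3] w = List.range' 1 n ↔ Avoids231 (sigmaPass w []) := by
  have hp : (sigmaPass w []).Perm (List.range' 1 n) :=
    (sigmaPass_perm w []).trans (by simpa using hw)
  have hnd : (sigmaPass w []).Nodup := hp.nodup_iff.2 List.nodup_range'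
  have := pairwise_increasingPass_iff (sigmaPass w []) [] (by simp) (by simpa using hnd)
  rw [List.reverse_nil, List.nil_append] at this
  rw [machine_eq_increasingPass, ← this]
  constructor
  · intro h
    rw [h]
    exact List.pairwise_lt_range'
  · intro h
    have hp' : (increasingPass (sigmaPass w []) []).Perm (List.range' 1 n) :=
      (increasingPass_perm _ _).trans (by simpa using hp)
    exact hp'.eq_of_pairwise (fun a b _ _ h₁ h₂ => absurd h₁ (by omega)) h
      List.pairwise_lt_range'

/-! ### Consequences of a pop when the output avoids 231 -/

theorem sublist_sigmaPass (w S : List ℕ) : S.Sublist (sigmaPass w S) := by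
  induction w, S using sigmaPass.induct with
  | case1 S => simp [sigmaPass]
  | case2 a w ih => exact List.nil_sublist _
  | case3 a w t S h ih =>
    rw [sigmaPass, if_pos h]
    exact ih.cons_cons t
  | case4 a w t S h ih =>
    rw [sigmaPass, if_neg h]
    exact (List.sublist_cons_self _ _).trans ih

theorem exists_sublist_of_not_avoids123_cons {a : ℕ} {S : List ℕ} (hS : Avoids123 S)
    (h : ¬ Avoids123 (a :: S)) : ∃ b c, [b, c].Sublist S ∧ a < b ∧ b < c := by
  rw [Avoids123, List.triplewise_cons, not_and_or, or_iff_left (not_not.2 hS),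
    List.pairwise_iff_forall_sublist] at h
  push Not at h
  obtain ⟨b, c, h₁, h₂⟩ := h
  exact ⟨b, c, h₁, h₂⟩

theorem not_avoids123_cons_of_sublist {a b c : ℕ} {S : List ℕ} (h : [b, c].Sublist S)
    (hab : a < b) (hbc : b < c) : ¬ Avoids123 (a :: S) := fun H =>
  List.pairwise_iff_forall_sublist.1 (List.triplewise_cons.1 H).1 h ⟨hab, hbc⟩

/-- The pair b < c that blocks `a` either starts with `t`, or lies below `t`; in the latter case t ≤
a would make t b c a 123 already present in the stack. -/
theorem lt_of_pop {a t : ℕ} {S : List ℕ} (hS : Avoids123 (t :: S))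
    (h : ¬ Avoids123 (a :: t :: S)) : a < t := by
  obtain ⟨b, c, hbc, h₁, h₂⟩ := exists_sublist_of_not_avoids123_cons hS h
  by_contra hat
  rcases List.sublist_cons_iff.1 hbc with hbc | ⟨r, hr, -⟩
  · exact not_avoids123_cons_of_sublist hbc (by omega) h₂ hS
  · simp only [List.cons.injEq] at hr
    omega

/-- A letter below `b` is always in the stack or next in the input: if the one in the stack is
popped, the letter causing this is smaller still (`lt_of_pop`) and takes over its role. When `y` is
pushed, such a letter lies underneath and leaves later. -/
theorem exists_sublist_sigmaPass_of_lt {b y : ℕ} {w S : List ℕ} (hS : Avoids123 S)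
    (hb : (∃ m ∈ S, m < b) ∨ ∃ a ∈ w.head?, a < b) (hy : y ∈ w) (hby : b < y) :
    ∃ z < b, [y, z].Sublist (sigmaPass w S) := by
  have push : ∀ a w S, y ∈ a :: w → ((∃ m ∈ S, m < b) ∨ ∃ x ∈ (a :: w).head?, x < b) →
      (((∃ m ∈ a :: S, m < b) ∨ ∃ x ∈ w.head?, x < b) → y ∈ w →
        ∃ z < b, [y, z].Sublist (sigmaPass w (a :: S))) →
      ∃ z < b, [y, z].Sublist (sigmaPass w (a :: S)) := by
    intro a w S hy hb ih
    by_cases hyw : y ∈ w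
    · refine ih (Or.inl ?_) hyw
      rcases hb with ⟨m, hm, hmb⟩ | ⟨x, hx, hxb⟩
      · exact ⟨m, List.mem_cons_of_mem _ hm, hmb⟩
      · simp only [List.head?_cons, Option.mem_some_iff] at hx
        exact ⟨x, by simp [hx], hxb⟩
    · obtain rfl : y = a := (List.mem_cons.1 hy).resolve_right hyw
      rcases hb with ⟨m, hm, hmb⟩ | ⟨x, hx, hxb⟩
      · refine ⟨m, hmb, List.Sublist.trans ?_ (sublist_sigmaPass w (y :: S))⟩
        exact (List.singleton_sublist.2 hm).cons_cons y
      · simp only [List.head?_cons, Option.mem_some_iff] at hx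
        omega
  induction w, S using sigmaPass.induct with
  | case1 S => simp at hy
  | case2 a w ih =>
    rw [sigmaPass]
    exact push a w [] hy hb fun h₁ h₂ => ih (by simp) h₁ h₂
  | case3 a w t S h ih =>
    rw [sigmaPass, if_pos h]
    have hat := lt_of_pop hS ((contains_iff_not_avoids123 _).1 h)
    obtain ⟨z, hz, hyz⟩ := ih (List.triplewise_cons.1 hS).2 (by
      rcases hb with ⟨m, hm, hmb⟩ | hb
      · rcases List.mem_cons.1 hm with rfl | hm
        · exact Or.inr ⟨a, by simp, by omega⟩
        · exact Or.inl ⟨m, hm, hmb⟩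
      · exact Or.inr hb) hy
    exact ⟨z, hz, hyz.cons t⟩
  | case4 a w t S h ih =>
    rw [sigmaPass, if_neg h]
    rw [contains_iff_not_avoids123, not_not] at h
    exact push a w (t :: S) hy hb fun h₁ h₂ => ih h h₁ h₂

/-- In a sorted permutation, nothing that is read after a letter has left the first stack exceeds
this letter. -/
theorem le_of_avoids231_pop {a t y : ℕ} {w S : List ℕ} (hS : Avoids123 S) (hat : a < t)
    (h : Avoids231 (t :: sigmaPass (a :: w) S)) (hy : y ∈ a :: w) : y ≤ t := by
  by_contra hty
  obtain ⟨z, hz, hyz⟩ := exists_sublist_sigmaPass_of_lt hS (Or.inr ⟨a, by simp, hat⟩) hy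
    (by omega)
  exact List.pairwise_iff_forall_sublist.1 (List.triplewise_cons.1 h).1 hyz ⟨hz, by omega⟩

/-- The pair b c blocks `a` until `b` itself is popped, and `le_of_avoids231_pop` applies at that
moment. -/
theorem le_of_avoids231_blocked {a b c : ℕ} {w S : List ℕ} (hS : Avoids123 S)
    (h : Avoids231 (sigmaPass (a :: w) S)) (hbc : [b, c].Sublist S) (hab : a < b) (hlt : b < c) :
    ∀ y ∈ a :: w, y ≤ b := by
  induction S with
  | nil => simp at hbc
  | cons t S ih =>
    rw [sigmaPass_pop (not_avoids123_cons_of_sublist hbc hab hlt)] at h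
    have hS' := (List.triplewise_cons.1 hS).2
    rcases List.sublist_cons_iff.1 hbc with hbc | ⟨r, hr, -⟩
    · exact ih hS' (List.triplewise_cons.1 h).2 hbc
    · obtain rfl : b = t := by simp_all
      exact fun y hy => le_of_avoids231_pop hS' hab h hy

theorem pair_sublist_of_getLast? {b k : ℕ} {S : List ℕ} (hk : S.getLast? = some k)
    (hb : b ∈ S) (hbk : b ≠ k) : [b, k].Sublist S := by
  obtain ⟨S, rfl⟩ := List.getLast?_eq_some_iff.1 hk
  have hb : b ∈ S := by simpa [hbk] using hb
  exact (List.singleton_sublist.2 hb).append (List.Sublist.refl [k])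

/-- The letters of a sorted permutation below its first letter `k` do not play the role of `2` in
an occurrence of `213`. -/
theorem avoids213_below_of_avoids231 {k : ℕ} {w S : List ℕ} (hS : Avoids123 S)
    (hk : S.getLast? = some k) (h : Avoids231 (sigmaPass w S)) :
    (∀ b ∈ S, b < k → w.Pairwise fun a c => ¬(a < b ∧ b < c)) ∧
      w.Triplewise fun b a c => b < k → ¬(a < b ∧ b < c) := by
  induction w, S using sigmaPass.induct with
  | case1 S => simp
  | case2 a w ih => simp at hk
  | case3 a w t S hc ih =>
    rw [contains_iff_not_avoids123] at hc
    have h' := h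
    rw [sigmaPass_pop hc] at h'
    have hS' := (List.triplewise_cons.1 hS).2
    have hne : S ≠ [] := by
      rintro rfl
      exact hc (List.triplewise_pair a t _)
    rw [List.getLast?_cons_of_ne_nil hne] at hk
    obtain ⟨h₁, h₂⟩ := ih hS' hk (List.triplewise_cons.1 h').2
    refine ⟨fun b hb hbk => ?_, h₂⟩
    rcases List.mem_cons.1 hb with rfl | hb
    · refine List.pairwise_iff_forall_sublist.2 fun {x y} hxy => ?_
      have := le_of_avoids231_pop hS' (lt_of_pop hS hc) h' (hxy.subset (by simp : y ∈ [x, y]))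
      omega
    · exact h₁ b hb hbk
  | case4 a w t S hc ih =>
    rw [contains_iff_not_avoids123, not_not] at hc
    have h' := h
    rw [sigmaPass_push hc] at h'
    obtain ⟨h₁, h₂⟩ := ih hc (by simpa using hk) h'
    refine ⟨fun b hb hbk => List.pairwise_cons.2
      ⟨fun c hcw hbc => ?_, h₁ b (List.mem_cons_of_mem _ hb) hbk⟩, List.triplewise_cons.2
      ⟨?_, h₂⟩⟩
    · have := le_of_avoids231_blocked hS h (pair_sublist_of_getLast? hk hb hbk.ne) hbc.1 hbk c
        (List.mem_cons_of_mem _ hcw)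
      omega
    · by_cases hak : a < k
      · exact (h₁ a (by simp) hak).imp fun h _ => h
      · exact List.pairwise_of_forall fun _ _ h => absurd h hak

/-! ### Block structure of the sorted permutations -/

theorem sigmaPass_append_of_avoids123 {P R S : List ℕ} (h : Avoids123 (P.reverse ++ S)) :
    sigmaPass (P ++ R) S = sigmaPass R (P.reverse ++ S) := by
  induction P generalizing S with
  | nil => simp
  | cons a P ih =>
    have h' : Avoids123 (P.reverse ++ (a :: S)) := by simpa using h
    rw [List.cons_append, sigmaPass_push (triplewise_of_append_right h'), ih h']
    simp

theorem avoids123_or_exists_first_pop {w S : List ℕ} (hS : Avoids123 S) :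
    Avoids123 (w.reverse ++ S) ∨ ∃ P a R, w = P ++ a :: R ∧ Avoids123 (P.reverse ++ S) ∧
      ¬ Avoids123 (a :: (P.reverse ++ S)) := by
  induction w generalizing S with
  | nil => exact Or.inl (by simpa using hS)
  | cons a w ih =>
    by_cases h : Avoids123 (a :: S)
    · rcases ih h with h | ⟨P, x, R, rfl, h₁, h₂⟩
      · exact Or.inl (by simpa using h)
      · exact Or.inr ⟨a :: P, x, R, rfl, by simpa using h₁, by simpa using h₂⟩
    · exact Or.inr ⟨[], a, w, rfl, by simpa using hS, by simpa using h⟩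

theorem sigmaPass_append_of_blocked {a b c : ℕ} {w S₁ S₂ : List ℕ} (h : [b, c].Sublist S₂)
    (hab : a < b) (hbc : b < c) :
    sigmaPass (a :: w) (S₁ ++ S₂) = S₁ ++ sigmaPass (a :: w) S₂ := by
  induction S₁ with
  | nil => rfl
  | cons t S₁ ih =>
    have h' : [b, c].Sublist (t :: (S₁ ++ S₂)) := h.trans (List.sublist_append_right (t :: S₁) _)
    rw [List.cons_append, sigmaPass_pop (not_avoids123_cons_of_sublist h' hab hbc), ih]
    rfl

theorem avoids123_append_of_pairwise_gt {l₁ l₂ : List ℕ} (h₁ : l₁.Pairwise (· > ·))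
    (h₂ : l₂.Pairwise (· > ·)) : Avoids123 (l₁ ++ l₂) := by
  have key : ∀ l : List ℕ, l.Pairwise (· > ·) → Avoids123 l := by
    intro l hl
    induction hl with
    | nil => exact .nil
    | cons _ hp ih => exact .cons (hp.imp fun h => by omega) ih
  exact List.triplewise_append.2 ⟨key _ h₁, key _ h₂, fun a _ => h₂.imp fun h => by omega,
    fun a _ => h₁.imp fun h => by omega⟩

theorem avoids231_of_pairwise_gt {l : List ℕ} (hl : l.Pairwise (· > ·)) : Avoids231 l := by
  induction hl with
  | nil => exact .nil
  | cons h hp ih =>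
    refine .cons (List.pairwise_iff_forall_sublist.2 fun {x y} hxy => ?_) ih
    have := h x (hxy.subset (by simp))
    omega

/-- The rest `L₁ A L₂ R` of a permutation with first letter `k` that the `123`-machine sorts. The
blocks `L₁` and `L₂` form an increasing sequence above `k`, and `A` and `R` lie below `k` and
together avoid `213`. Up to the first letter of `R`, nothing leaves the first stack. -/
structure IsSortedTail (k : ℕ) (L₁ A L₂ R : List ℕ) : Prop where
  pairwise_large : (L₁ ++ L₂).Pairwise (· < ·)
  lt_of_mem_large : ∀ x ∈ L₁ ++ L₂, k < x
  pairwise_run : A.Pairwise (· < ·)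
  lt_of_mem_small : ∀ x ∈ A ++ R, x < k
  avoids213 : Avoids213 (A ++ R)
  exists_lt : ∀ a ∈ R.head?, ∃ b ∈ A, a < b

/-- With k at the bottom of the stack, avoiding 123 makes the letters of `P` below k increase in
order of arrival, and avoiding 231 does the same for those above k. Small letters a, x separated by
a large y would satisfy a < x and stand in the stack as the 231 x y a, so the small letters are
contiguous. -/
theorem exists_blocks_of_avoids {k : ℕ} {P : List ℕ} (hk : k ∉ P)
    (h₁₂₃ : Avoids123 (P.reverse ++ [k])) (h₂₃₁ : Avoids231 (P.reverse ++ [k]))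
    (hnd : P.Nodup) :
    ∃ L₁ A L₂, P = L₁ ++ A ++ L₂ ∧ (L₁ ++ L₂).Pairwise (· < ·) ∧
      (∀ x ∈ L₁ ++ L₂, k < x) ∧ A.Pairwise (· < ·) ∧ ∀ x ∈ A, x < k := by
  unfold Avoids123 at h₁₂₃
  unfold Avoids231 at h₂₃₁
  rw [← List.reverse_cons, List.triplewise_reverse, List.triplewise_cons] at h₁₂₃ h₂₃₁
  have hne : ∀ x ∈ P, x ≠ k := by rintro x hx rfl; exact hk hx
  have hL₁ : ∀ x ∈ P.takeWhile (k < ·), k < x := fun x hx => by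
    simpa using List.mem_takeWhile_imp hx
  have hP : P.takeWhile (k < ·) ++ P.dropWhile (k < ·) = P := List.takeWhile_append_dropWhile
  set L₁ := P.takeWhile (k < ·)
  have hQ : ∀ x ∈ (P.dropWhile (k < ·)).head?, x < k := fun x hx => by
    have := List.head?_dropWhile_not (k < ·) P
    have h₁ := hne x (by rw [← hP]; exact List.mem_append_right _ (List.mem_of_mem_head? hx))
    rw [Option.mem_def] at hx
    rw [hx] at this
    simp at this
    omega
  set Q := P.dropWhile (k < ·)
  have hA : ∀ x ∈ Q.takeWhile (· < k), x < k := fun x hx => by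
    simpa using List.mem_takeWhile_imp hx
  have hQA : Q.takeWhile (· < k) ++ Q.dropWhile (· < k) = Q := List.takeWhile_append_dropWhile
  have hL₂ : ∀ x ∈ Q.dropWhile (· < k), k < x := by
    have hhead : ∀ x ∈ (Q.dropWhile (· < k)).head?, k < x := fun x hx => by
      have := List.head?_dropWhile_not (· < k) Q
      have h₁ := hne x (by
        rw [← hP, ← hQA]
        exact List.mem_append_right _ (List.mem_append_right _ (List.mem_of_mem_head? hx)))
      rw [Option.mem_def] at hx
      rw [hx] at this
      simp at this
      omega
    -- This supplies the small letter in front of `L₂` for the forbidden small-large-small triple.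
    have hAne : Q ≠ [] → Q.takeWhile (· < k) ≠ [] := by
      intro hQ0
      obtain ⟨q, Q', hq⟩ := List.exists_cons_of_ne_nil hQ0
      have := hQ q (by simp [hq])
      simp [hq, this]
    generalize hA' : Q.takeWhile (· < k) = A at *
    generalize hL' : Q.dropWhile (· < k) = L₂ at *
    intro x hx
    by_contra hxk
    rcases L₂ with _ | ⟨y, L₂⟩
    · simp at hx
    · have hky := hhead y (by simp)
      have hx : x ∈ L₂ := by
        rcases List.mem_cons.1 hx with rfl | hx
        · omega
        · exact hx
      rcases A with _ | ⟨a, A⟩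
      · exact hAne (by rw [← hQA]; simp) rfl
      · have hak := hA a (by simp)
        have hsub : [a, y, x].Sublist P := by
          rw [← hP, ← hQA]
          refine List.Sublist.trans ?_ (List.sublist_append_right _ _)
          refine List.Sublist.append (l₁ := [a]) (l₂ := a :: A) ?_ ?_
          · simp
          · simpa using hx
        have h₁ := List.triplewise_triple.1 (triplewise_of_sublist hsub h₂₃₁.2)
        have hsub' : [a, x].Sublist P := List.Sublist.trans (by simp) hsub
        have h₂ := List.pairwise_iff_forall_sublist.1 h₁₂₃.1 hsub'
        have h₃ := List.pairwise_iff_forall_sublist.1 hnd hsub'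
        omega
  refine ⟨L₁, Q.takeWhile (· < k), Q.dropWhile (· < k), by rw [List.append_assoc, hQA, hP],
    ?_, ?_, ?_, hA⟩
  · refine List.pairwise_iff_forall_sublist.2 fun {x y} hxy => ?_
    have hsub : [x, y].Sublist P := by
      refine hxy.trans ?_
      conv_rhs => rw [← hP, ← hQA]
      exact (List.Sublist.refl _).append (List.sublist_append_right _ _)
    have h₂ := List.pairwise_iff_forall_sublist.1 h₂₃₁.1 hsub
    have h₃ := List.pairwise_iff_forall_sublist.1 hnd hsub
    have h₄ : k < y := by
      have : y ∈ L₁ ++ Q.dropWhile (· < k) := hxy.subset (by simp)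
      rcases List.mem_append.1 this with h | h
      · exact hL₁ y h
      · exact hL₂ y h
    omega
  · intro x hx
    rcases List.mem_append.1 hx with h | h
    · exact hL₁ x h
    · exact hL₂ x h
  · refine List.pairwise_iff_forall_sublist.2 fun {x y} hxy => ?_
    have hsub : [x, y].Sublist P := by
      refine hxy.trans ?_
      rw [← hP]
      exact (List.takeWhile_sublist _).trans (List.sublist_append_right _ _)
    have h₂ := List.pairwise_iff_forall_sublist.1 h₁₂₃.1 hsub
    have h₃ := List.pairwise_iff_forall_sublist.1 hnd hsub
    have h₄ := hA x (hxy.subset (by simp))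
    omega

theorem exists_isSortedTail {k : ℕ} {w : List ℕ} (hnd : (k :: w).Nodup)
    (h : Avoids231 (sigmaPass (k :: w) [])) :
    ∃ L₁ A L₂ R, w = L₁ ++ A ++ L₂ ++ R ∧ IsSortedTail k L₁ A L₂ R := by
  rw [sigmaPass] at h
  have hS : Avoids123 [k] := List.triplewise_singleton _ _
  have h213 := (avoids213_below_of_avoids231 (k := k) hS (by simp) h).2
  rw [List.nodup_cons] at hnd
  -- The proviso b < k in `h213` is automatic on words of small letters.
  have restrict : ∀ l : List ℕ, l.Sublist w → (∀ x ∈ l, x < k) → Avoids213 l := by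
    intro l hl hlk
    have := triplewise_of_sublist hl h213
    clear hl
    induction this with
    | nil => exact .nil
    | cons hp _ ih =>
      exact .cons (hp.imp fun h => h (hlk _ (by simp)))
        (ih fun x hx => hlk x (List.mem_cons_of_mem _ hx))
  rcases avoids123_or_exists_first_pop (w := w) hS with hw | ⟨P, a, R, rfl, hP, hpop⟩
  · have hpass := sigmaPass_append_of_avoids123 (R := []) hw
    rw [List.append_nil, sigmaPass_nil] at hpass
    rw [hpass] at h
    obtain ⟨L₁, A, L₂, rfl, h₁, h₂, h₃, h₄⟩ := exists_blocks_of_avoids hnd.1 hw h hnd.2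
    refine ⟨L₁, A, L₂, [], by simp, h₁, h₂, h₃, by simpa using h₄, ?_, by simp⟩
    rw [List.append_nil]
    refine restrict A ?_ h₄
    exact (List.sublist_append_right _ _).trans (List.sublist_append_left _ _)
  · rw [sigmaPass_append_of_avoids123 hP] at h
    have hP231 := triplewise_of_sublist (sublist_sigmaPass _ _) h
    have hkP : k ∉ P := fun hk => hnd.1 (List.mem_append_left _ hk)
    have hndP : P.Nodup := (List.nodup_append.1 hnd.2).1
    -- Otherwise the letters of `P` above `a` all exceed k, so `a` is blocked by some x < y in the
    -- stack above k, and x y k is a 231 that reaches the output.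
    obtain ⟨b, hb, hab, hbk⟩ : ∃ b ∈ P, a < b ∧ b < k := by
      by_contra hcon
      push Not at hcon
      refine hpop (List.triplewise_cons.2 ⟨List.pairwise_append.2 ⟨?_, by simp, ?_⟩, hP⟩)
      · refine List.pairwise_iff_forall_sublist.2 fun {x y} hxy hlt => ?_
        have hxP : x ∈ P := List.mem_reverse.1 (hxy.subset (by simp))
        have h₁ := hcon x hxP hlt.1
        have h₂ : x ≠ k := by rintro rfl; exact hkP hxP
        have := List.triplewise_triple.1
          (triplewise_of_sublist (hxy.append (List.Sublist.refl [k])) hP231)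
        omega
      · intro x hx y hy hlt
        have := hcon x (List.mem_reverse.1 hx) hlt.1
        simp only [List.mem_singleton] at hy
        omega
    -- Since b and k block `a`, everything from `a` on lies below b, hence below k.
    have hbR : ∀ y ∈ a :: R, y < b := by
      intro y hy
      have h₁ := le_of_avoids231_blocked hP h (pair_sublist_of_getLast? (by simp)
        (List.mem_append_left _ (List.mem_reverse.2 hb)) hbk.ne) hab hbk y hy
      have h₂ := (List.nodup_append.1 hnd.2).2.2 b hb y hy
      omega
    obtain ⟨L₁, A, L₂, rfl, h₁, h₂, h₃, h₄⟩ := exists_blocks_of_avoids hkP hP hP231 hndP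
    have hsmall : ∀ x ∈ A ++ a :: R, x < k := by
      intro x hx
      rcases List.mem_append.1 hx with hx | hx
      · exact h₄ x hx
      · exact (hbR x hx).trans hbk
    refine ⟨L₁, A, L₂, a :: R, rfl, h₁, h₂, h₃, hsmall, ?_, ?_⟩
    · refine restrict _ (List.Sublist.append ?_ (List.Sublist.refl _)) hsmall
      exact (List.sublist_append_right _ _).trans (List.sublist_append_left _ _)
    · intro x hx
      obtain rfl : a = x := by simpa using hx
      refine ⟨b, ?_, hab⟩
      simp only [List.mem_append] at hb
      rcases hb with (hb | hb) | hb
      · have := h₂ b (List.mem_append_left _ hb)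
        omega
      · exact hb
      · have := h₂ b (List.mem_append_right _ hb)
        omega

/-! ### Every word of this block structure is sorted -/

/-- On top of `X`, which contains k, a small letter is blocked by every larger letter of `B`
together with k. It therefore pops precisely those, and `B` remains decreasing. By 213-avoidance a
popped letter exceeds all small letters still to come, so the small letters leave in decreasing
order. -/
theorem exists_sigmaPass_eq_append {k : ℕ} {R B X : List ℕ} (hX : X.Pairwise (· > ·))
    (hk : k ∈ X) (hsmall : ∀ x ∈ B ++ R, x < k) (hB : B.Pairwise (· > ·))
    (h213 : Avoids213 (B.reverse ++ R)) (hnd : (B.reverse ++ R).Nodup) :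
    ∃ D, sigmaPass R (B ++ X) = D ++ X ∧ D.Pairwise (· > ·) ∧ D.Perm (B ++ R) := by
  induction R generalizing B with
  | nil => exact ⟨B, by simp [sigmaPass_nil], hB, by simp⟩
  | cons a R ihR =>
    have push : ∀ B : List ℕ, (∀ x ∈ B ++ a :: R, x < k) → (a :: B).Pairwise (· > ·) →
        Avoids213 (B.reverse ++ a :: R) → (B.reverse ++ a :: R).Nodup →
        ∃ D, sigmaPass (a :: R) (B ++ X) = D ++ X ∧ D.Pairwise (· > ·) ∧
          D.Perm (B ++ a :: R) := by
      intro B hs hp h213 hnd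
      obtain ⟨D, h₁, h₂, h₃⟩ := ihR (B := a :: B) (fun x hx => hs x (by
        simp only [List.cons_append, List.mem_cons, List.mem_append] at hx ⊢; tauto)) hp
        (by simpa using h213) (by simpa using hnd)
      refine ⟨D, ?_, h₂, h₃.trans List.perm_middle.symm⟩
      have hav : Avoids123 (a :: (B ++ X)) := avoids123_append_of_pairwise_gt hp hX
      rw [sigmaPass_push hav]
      exact h₁
    induction B with
    | nil => exact push [] hsmall (by simp) h213 hnd
    | cons t B ihB =>
      have hB' := List.pairwise_cons.1 hB
      have e : (t :: B).reverse ++ a :: R = B.reverse ++ (t :: a :: R) := by simp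
      have hta : t ≠ a := by
        rw [e] at hnd
        have := (List.nodup_append.1 hnd).2.1
        simp only [List.nodup_cons, List.mem_cons, not_or] at this
        exact this.1.1
      by_cases hat : a < t
      · have hsub : (B.reverse ++ a :: R).Sublist ((t :: B).reverse ++ a :: R) := by
          rw [e]
          exact (List.Sublist.refl _).append (List.sublist_cons_self _ _)
        obtain ⟨D, h₁, h₂, h₃⟩ := ihB (fun x hx => hsmall x (List.mem_cons_of_mem _ hx)) hB'.2
          (triplewise_of_sublist hsub h213) (hnd.sublist hsub)
        refine ⟨t :: D, ?_, List.pairwise_cons.2 ⟨fun x hx => ?_, h₂⟩, h₃.cons t⟩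
        · have hpair : [t, k].Sublist (t :: (B ++ X)) := List.Sublist.cons_cons t
            (List.singleton_sublist.2 (List.mem_append_right _ hk))
          rw [List.cons_append, sigmaPass_pop
            (not_avoids123_cons_of_sublist hpair hat (hsmall t (by simp))), h₁]
          rfl
        · rcases List.mem_append.1 (h₃.mem_iff.1 hx) with hx | hx
          · exact hB'.1 x hx
          · rcases List.mem_cons.1 hx with rfl | hx
            · exact hat
            -- A later x above t would make t a x a 213.
            · rw [e] at h213 hnd
              have h₄ := List.triplewise_cons.1 (triplewise_of_append_right h213)
              have h₅ := (List.pairwise_cons.1 h₄.1).1 x hx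
              have h₆ := (List.nodup_cons.1 (List.nodup_append.1 hnd).2.1).1
              have h₇ : t ≠ x := by rintro rfl; exact h₆ (List.mem_cons_of_mem _ hx)
              omega
      · refine push (t :: B) hsmall (List.pairwise_cons.2 ⟨fun x hx => ?_, hB⟩) h213 hnd
        rcases List.mem_cons.1 hx with rfl | hx
        · omega
        · have := hB'.1 x hx
          omega

theorem avoids231_sigmaPass_of_isSortedTail {k : ℕ} {L₁ A L₂ R : List ℕ}
    (h : IsSortedTail k L₁ A L₂ R) (hnd : (A ++ R).Nodup) :
    Avoids231 (sigmaPass (k :: (L₁ ++ A ++ L₂ ++ R)) []) := by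
  obtain ⟨h₁, h₂, h₃, h₄, h₅, h₆⟩ := h
  have h₁' := List.pairwise_append.1 h₁
  have hX : (L₁.reverse ++ [k]).Pairwise (· > ·) := by
    rw [← List.reverse_cons, List.pairwise_reverse]
    exact List.pairwise_cons.2 ⟨fun x hx => h₂ x (List.mem_append_left _ hx), h₁'.1⟩
  have hA : A.reverse.Pairwise (· > ·) := List.pairwise_reverse.2 h₃
  have hL₂ : L₂.reverse.Pairwise (· > ·) := List.pairwise_reverse.2 h₁'.2.1
  have hL₂A : (L₂.reverse ++ A.reverse).Pairwise (· > ·) := by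
    refine List.pairwise_append.2 ⟨hL₂, hA, fun x hx y hy => ?_⟩
    have := h₂ x (List.mem_append_right _ (List.mem_reverse.1 hx))
    have := h₄ y (List.mem_append_left _ (List.mem_reverse.1 hy))
    omega
  have e : (L₁ ++ A ++ L₂).reverse ++ [k] = (L₂.reverse ++ A.reverse) ++ (L₁.reverse ++ [k]) := by
    simp
  rw [sigmaPass, sigmaPass_append_of_avoids123
    (by rw [e]; exact avoids123_append_of_pairwise_gt hL₂A hX), e]
  obtain ⟨D, hD₁, hD₂, hD₃⟩ := exists_sigmaPass_eq_append (k := k) (R := R) (B := A.reverse) hX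
    (by simp) (by simpa using h₄) hA (by simpa using h₅) (by simpa using hnd)
  have hpass : sigmaPass R (L₂.reverse ++ A.reverse ++ (L₁.reverse ++ [k])) =
      (L₂.reverse ++ D) ++ (L₁.reverse ++ [k]) := by
    rw [List.append_assoc, List.append_assoc, ← hD₁]
    -- The first letter of `R` is blocked by some b in `A` together with k, both below `L₂` in the
    -- stack, so all of `L₂` leaves first; if `R` is empty, the stack is simply emptied.
    rcases R with _ | ⟨a, R⟩
    · simp [sigmaPass_nil]
    · obtain ⟨b, hb, hab⟩ := h₆ a (by simp)
      refine sigmaPass_append_of_blocked (b := b) (c := k) ?_ hab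
        (h₄ b (List.mem_append_left _ hb))
      exact (List.singleton_sublist.2 (List.mem_reverse.2 hb)).append
        (List.sublist_append_right _ _)
  rw [hpass]
  have hDk : ∀ x ∈ D, x < k := fun x hx => h₄ x (by simpa using hD₃.mem_iff.1 hx)
  have hC : (L₂.reverse ++ D).Pairwise (· > ·) := by
    refine List.pairwise_append.2 ⟨hL₂, hD₂, fun x hx y hy => ?_⟩
    have := h₂ x (List.mem_append_right _ (List.mem_reverse.1 hx))
    have := hDk y hy
    omega
  -- A 231 would need its 2 in the first decreasing part and its 3 and 1 in the second. But letters
  -- of `L₂` exceed the whole second part, and those of `D` are below it.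
  refine List.triplewise_append.2 ⟨avoids231_of_pairwise_gt hC, avoids231_of_pairwise_gt hX,
    fun x hx => ?_, fun x _ => hC.imp fun h => by omega⟩
  refine List.pairwise_iff_forall_sublist.2 fun {y z} hyz hlt => ?_
  have hy : y ∈ L₁.reverse ++ [k] := hyz.subset (by simp)
  have hz : z ∈ L₁.reverse ++ [k] := hyz.subset (by simp)
  simp only [List.mem_append, List.mem_reverse, List.mem_singleton] at hx hy hz
  rcases hx with hx | hx
  · rcases hy with hy | rfl
    · have := h₁'.2.2 y hy x hx
      omega
    · have := h₂ x (List.mem_append_right _ hx)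
      omega
  · have := hDk x hx
    rcases hz with hz | rfl
    · have := h₂ z (List.mem_append_left _ hz)
      omega
    · omega

/-! ### Binary trees and the 213-avoiding words -/

/-- The word with the letters `c, c + 1, …` that a binary tree encodes: the root stands for the
letter `c`, and the words of the left and of the right subtree are placed before and after it, the
former with larger letters than the latter. -/
def treeWord : ℕ → BinaryTree Unit → List ℕ
  | _, .nil => []
  | c, .node _ l r => treeWord (c + 1 + r.numNodes) l ++ c :: treeWord (c + 1) r

theorem treeWord_perm (c : ℕ) (t : BinaryTree Unit) :
    (treeWord c t).Perm (List.range' c t.numNodes) := by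
  induction t generalizing c with
  | nil => simp [treeWord, BinaryTree.numNodes]
  | node u l r ihl ihr =>
    rw [treeWord, BinaryTree.numNodes, List.range'_succ]
    refine List.perm_middle.trans (List.Perm.cons c ?_)
    refine ((ihl _).append (ihr _)).trans (List.perm_append_comm.trans ?_)
    rw [Nat.add_comm l.numNodes, ← List.range'_append_1]

theorem mem_treeWord {c : ℕ} {t : BinaryTree Unit} {x : ℕ} :
    x ∈ treeWord c t ↔ c ≤ x ∧ x < c + t.numNodes := by
  rw [(treeWord_perm c t).mem_iff, List.mem_range'_1]

theorem avoids213_treeWord (c : ℕ) (t : BinaryTree Unit) : Avoids213 (treeWord c t) := by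
  induction t generalizing c with
  | nil => exact .nil
  | node u l r ihl ihr =>
    rw [treeWord]
    refine List.triplewise_append.2 ⟨ihl _, .cons ?_ (ihr _), fun x hx => ?_, fun x hx => ?_⟩
    · refine List.pairwise_iff_forall_sublist.2 fun {y z} hyz => ?_
      have := mem_treeWord.1 (hyz.subset (by simp : y ∈ [y, z]))
      omega
    · refine List.pairwise_iff_forall_sublist.2 fun {y z} hyz => ?_
      have hx := mem_treeWord.1 hx
      rcases List.mem_cons.1 (hyz.subset (by simp : z ∈ [y, z])) with rfl | hz
      · omega
      · have := mem_treeWord.1 hz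
        omega
    · refine List.pairwise_iff_forall_sublist.2 fun {y z} hyz => ?_
      have hy := mem_treeWord.1 (hyz.subset (by simp : y ∈ [y, z]))
      rcases List.mem_cons.1 hx with rfl | hx
      · omega
      · have := mem_treeWord.1 hx
        omega

theorem treeWord_injective (c : ℕ) : Function.Injective (treeWord c) := by
  intro t
  induction t generalizing c with
  | nil =>
    intro t' h
    cases t' with
    | nil => rfl
    | node => simp [treeWord] at h
  | node u l r ihl ihr =>
    intro t' h
    cases t' with
    | nil => simp [treeWord] at h
    | node u' l' r' =>
      rw [treeWord, treeWord] at h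
      have hn : ∀ (d : ℕ) (t : BinaryTree Unit), c ∉ treeWord (c + 1 + d) t := by
        intro d t hc
        have := mem_treeWord.1 hc
        omega
      obtain ⟨h₁, -, h₂⟩ := (List.append_cons_inj_of_notMem (hn _ _) (hn 0 _)).1 h
      -- The right subtree has to be identified first: its size enters the offset of the left word.
      obtain rfl := ihr _ h₂
      rw [ihl _ h₁]

/-- Sorting both lists separately already sorts their concatenation, so the two results are
consecutive pieces of the interval. -/
theorem perm_range'_of_append_perm {c : ℕ} {l₁ l₂ : List ℕ} (hlt : ∀ x ∈ l₁, ∀ y ∈ l₂, x < y)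
    (hp : (l₁ ++ l₂).Perm (List.range' c (l₁.length + l₂.length))) :
    l₁.Perm (List.range' c l₁.length) ∧ l₂.Perm (List.range' (c + l₁.length) l₂.length) := by
  have h₁ := List.perm_insertionSort (· ≤ ·) l₁
  have h₂ := List.perm_insertionSort (· ≤ ·) l₂
  rw [← List.range'_append_1] at hp
  have heq : l₁.insertionSort (· ≤ ·) ++ l₂.insertionSort (· ≤ ·) =
      List.range' c l₁.length ++ List.range' (c + l₁.length) l₂.length := by
    refine ((h₁.append h₂).trans hp).eq_of_pairwise (le := (· ≤ ·))
      (fun _ _ _ _ => le_antisymm) ?_ ?_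
    · exact List.pairwise_append.2 ⟨List.pairwise_insertionSort _ _,
        List.pairwise_insertionSort _ _,
        fun x hx y hy => (hlt x (h₁.mem_iff.1 hx) y (h₂.mem_iff.1 hy)).le⟩
    · rw [List.range'_append_1]
      exact List.Pairwise.imp le_of_lt (List.pairwise_lt_range')
  obtain ⟨e₁, e₂⟩ := List.append_inj heq (by simp)
  exact ⟨e₁ ▸ h₁.symm, e₂ ▸ h₂.symm⟩

/-- Split at the least letter c: a letter y before c and a letter x after it with y < x would form
the 213 y c x. So the left part lies above the right part, both are intervals, and recursion yields
the subtrees. -/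
theorem exists_treeWord_eq {c m : ℕ} {w : List ℕ} (hp : w.Perm (List.range' c m))
    (h : Avoids213 w) : ∃ t : BinaryTree Unit, t.numNodes = m ∧ treeWord c t = w := by
  induction m using Nat.strong_induction_on generalizing c w with
  | _ m ih =>
  rcases m with _ | m
  · exact ⟨.nil, rfl, by rw [treeWord]; simpa using hp.symm⟩
  · obtain ⟨L, R, rfl⟩ := List.append_of_mem
      (hp.mem_iff.2 (by simp [List.mem_range'_1] : c ∈ List.range' c (m + 1)))
    have hnd := hp.nodup_iff.2 List.nodup_range'
    have hp' : (L ++ R).Perm (List.range' (c + 1) m) := by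
      rw [List.range'_succ] at hp
      exact (List.perm_middle.symm.trans hp).cons_inv
    have hlen : L.length + R.length = m := by simpa using hp'.length_eq
    have hlt : ∀ x ∈ R, ∀ y ∈ L, x < y := by
      intro x hx y hy
      have h₁ := List.triplewise_triple.1 (triplewise_of_sublist
        ((List.singleton_sublist.2 hy).append ((List.singleton_sublist.2 hx).cons_cons c)) h)
      have h₂ := List.mem_range'_1.1 (hp'.mem_iff.1 (List.mem_append_left R hy))
      have h₃ := (List.nodup_append.1 hnd).2.2 y hy x (List.mem_cons_of_mem _ hx)
      omega
    obtain ⟨hR, hL⟩ := perm_range'_of_append_perm (c := c + 1) hlt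
      (List.perm_append_comm.trans (by rwa [Nat.add_comm R.length, hlen]))
    have h' := List.triplewise_append.1 h
    obtain ⟨r, hr₁, hr₂⟩ := ih _ (by omega) hR (List.triplewise_cons.1 h'.2.1).2
    obtain ⟨l, hl₁, hl₂⟩ := ih _ (by omega) hL h'.1
    exact ⟨.node () l r, by rw [BinaryTree.numNodes, hl₁, hr₁, hlen],
      by rw [treeWord, hr₁, hl₂, hr₂]⟩

/-- The permutations of `1, …, h` that avoid `213`. -/
def avoiders213 (h : ℕ) : Finset (List ℕ) :=
  (BinaryTree.treesOfNumNodesEq h).image (treeWord 1)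

theorem card_avoiders213 (h : ℕ) : (avoiders213 h).card = catalan h := by
  rw [avoiders213, Finset.card_image_of_injective _ (treeWord_injective 1),
    BinaryTree.treesOfNumNodesEq_card_eq_catalan]

theorem mem_avoiders213 {h : ℕ} {w : List ℕ} :
    w ∈ avoiders213 h ↔ w.Perm (List.range' 1 h) ∧ Avoids213 w := by
  simp only [avoiders213, Finset.mem_image, BinaryTree.mem_treesOfNumNodesEq]
  constructor
  · rintro ⟨t, rfl, rfl⟩
    exact ⟨treeWord_perm 1 t, avoids213_treeWord 1 t⟩
  · rintro ⟨hp, h213⟩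
    exact exists_treeWord_eq hp h213

/-! ### First runs and the enumeration -/

/-- The longest increasing prefix of a list. -/
def firstRun : List ℕ → List ℕ
  | [] => []
  | [a] => [a]
  | a :: b :: w => if a < b then a :: firstRun (b :: w) else [a]

/-- What remains of a list after its longest increasing prefix. -/
def afterRun (w : List ℕ) : List ℕ := w.drop (firstRun w).length

theorem firstRun_prefix (w : List ℕ) : firstRun w <+: w := by
  induction w using firstRun.induct with
  | case1 => simp [firstRun]
  | case2 a => simp [firstRun]
  | case3 a b w h ih =>
    rw [firstRun, if_pos h]
    exact (List.prefix_cons_inj a).2 ih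
  | case4 a b w h =>
    rw [firstRun, if_neg h]
    exact ⟨b :: w, rfl⟩

theorem firstRun_append_afterRun (w : List ℕ) : firstRun w ++ afterRun w = w :=
  List.prefix_iff_eq_append.1 (firstRun_prefix w)

theorem head?_firstRun (w : List ℕ) : (firstRun w).head? = w.head? := by
  induction w using firstRun.induct with
  | case1 => simp [firstRun]
  | case2 a => simp [firstRun]
  | case3 a b w h ih => simp [firstRun, h]
  | case4 a b w h => simp [firstRun, h]

theorem pairwise_firstRun (w : List ℕ) : (firstRun w).Pairwise (· < ·) := by
  rw [← List.isChain_iff_pairwise]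
  induction w using firstRun.induct with
  | case1 => simp [firstRun]
  | case2 a => simp [firstRun]
  | case3 a b w h ih =>
    rw [firstRun, if_pos h]
    refine List.IsChain.cons ih ?_
    rw [head?_firstRun]
    simpa using h
  | case4 a b w h => simp [firstRun, h]

theorem exists_lt_of_mem_head?_afterRun {w : List ℕ} (hnd : w.Nodup) :
    ∀ a ∈ (afterRun w).head?, ∃ b ∈ firstRun w, a < b := by
  induction w using firstRun.induct with
  | case1 => simp [afterRun]
  | case2 a => simp [afterRun, firstRun]
  | case3 a b w h ih =>
    intro x hx
    obtain ⟨y, hy, hxy⟩ := ih (List.nodup_cons.1 hnd).2 x (by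
      simpa [afterRun, firstRun, h] using hx)
    exact ⟨y, by simp [firstRun, h, hy], hxy⟩
  | case4 a b w h =>
    intro x hx
    obtain rfl : b = x := by simpa [afterRun, firstRun, h] using hx
    refine ⟨a, by simp [firstRun, h], ?_⟩
    have : a ≠ b := by rintro rfl; simp at hnd
    omega

/-- The condition on the head of `R` says that the run `A` cannot be prolonged, because a letter
below some letter of `A` is below its last one. Thus `A` and `R` can be recovered from `A ++ R`. -/
theorem firstRun_append {A R : List ℕ} (hA : A.Pairwise (· < ·))
    (hR : ∀ a ∈ R.head?, ∃ b ∈ A, a < b) : firstRun (A ++ R) = A := by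
  induction A with
  | nil =>
    rcases R with _ | ⟨a, R⟩
    · rfl
    · simpa using hR a
  | cons x A ih =>
    have hA' := List.pairwise_cons.1 hA
    rcases A with _ | ⟨y, A⟩
    · rcases R with _ | ⟨a, R⟩
      · rfl
      · have : a < x := by simpa using hR a
        simp [firstRun, this.le]
    · have hxy := hA'.1 y (by simp)
      rw [List.cons_append, List.cons_append, firstRun, if_pos hxy, ← List.cons_append,
        ih hA'.2]
      intro a ha
      obtain ⟨b, hb, hab⟩ := hR a ha
      rcases List.mem_cons.1 hb with rfl | hb
      · exact ⟨y, by simp, hab.trans hxy⟩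
      · exact ⟨b, hb, hab⟩

theorem range'_eq_append_cons (h m : ℕ) :
    List.range' 1 (h + m + 1) = List.range' 1 h ++ (h + 1) :: List.range' (h + 2) m := by
  rw [show h + 2 = h + 1 + 1 from rfl, ← List.range'_succ, Nat.add_comm h 1,
    List.range'_append_1, Nat.add_assoc]

/-- The sorted permutation of `1, …, n` with first letter `h + 1` whose smaller letters form the
word `w` and whose larger letters, except the first `i` of them, follow the first run of `w`. -/
def sortedWord (n h i : ℕ) (w : List ℕ) : List ℕ :=
  (h + 1) :: (List.range' (h + 2) i ++ firstRun w ++ List.range' (h + 2 + i) (n - 1 - h - i) ++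
    afterRun w)

theorem sortedWord_perm {n h i : ℕ} {w : List ℕ} (hi : h + i < n)
    (hw : w.Perm (List.range' 1 h)) : (sortedWord n h i w).Perm (List.range' 1 n) := by
  obtain ⟨m, rfl⟩ := Nat.exists_eq_add_of_lt hi
  have e : List.range' 1 (h + i + m + 1) = List.range' 1 h ++ (h + 1) ::
      (List.range' (h + 2) i ++ List.range' (h + 2 + i) m) := by
    rw [List.range'_append_1, ← range'_eq_append_cons, Nat.add_assoc h]
  have e' : h + i + m + 1 - 1 - h - i = m := by omega
  rw [e, sortedWord, e']
  refine List.Perm.trans (List.Perm.cons _ ?_) List.perm_middle.symm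
  refine List.Perm.trans ?_ (hw.append_right _)
  conv_rhs => rw [← firstRun_append_afterRun w]
  rw [List.perm_iff_count]
  intro x
  simp only [List.count_append]
  omega

theorem isSortedTail_of_mem_avoiders213 {n h i : ℕ} {w : List ℕ} (hw : w ∈ avoiders213 h) :
    IsSortedTail (h + 1) (List.range' (h + 2) i) (firstRun w)
      (List.range' (h + 2 + i) (n - 1 - h - i)) (afterRun w) := by
  obtain ⟨hp, h213⟩ := mem_avoiders213.1 hw
  refine ⟨?_, ?_, pairwise_firstRun w, ?_, ?_,
    exists_lt_of_mem_head?_afterRun (hp.nodup_iff.2 List.nodup_range')⟩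
  · rw [List.range'_append_1]
    exact List.pairwise_lt_range'
  · rw [List.range'_append_1]
    intro x hx
    have := List.mem_range'_1.1 hx
    omega
  · rw [firstRun_append_afterRun]
    intro x hx
    have := List.mem_range'_1.1 (hp.mem_iff.1 hx)
    omega
  · rwa [firstRun_append_afterRun]

/-- The first letter gives h, the letters up to h spell w, and i is the number of large letters
before the first small one. The last step needs a small letter, hence `1 ≤ h`. -/
theorem sortedWord_injOn {n h h' i i' : ℕ} {w w' : List ℕ} (hh : 1 ≤ h)
    (hw : w.Perm (List.range' 1 h)) (hw' : w'.Perm (List.range' 1 h'))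
    (heq : sortedWord n h i w = sortedWord n h' i' w') : h = h' ∧ i = i' ∧ w = w' := by
  simp only [sortedWord, List.cons.injEq, Nat.add_right_cancel_iff] at heq
  obtain ⟨rfl, heq⟩ := heq
  have hfilter : ∀ (i : ℕ) (w : List ℕ), w.Perm (List.range' 1 h) →
      (List.range' (h + 2) i ++ firstRun w ++ List.range' (h + 2 + i) (n - 1 - h - i) ++
        afterRun w).filter (· ≤ h) = w := by
    intro i w hw
    have hle : ∀ x ∈ firstRun w ++ afterRun w, x ≤ h := by
      rw [firstRun_append_afterRun]
      intro x hx
      have := List.mem_range'_1.1 (hw.mem_iff.1 hx)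
      omega
    have hgt : ∀ a m, h < a → (List.range' a m).filter (· ≤ h) = [] := by
      intro a m ha
      refine List.filter_eq_nil_iff.2 fun x hx => ?_
      have := List.mem_range'_1.1 hx
      simp
      omega
    rw [List.filter_append, List.filter_append, List.filter_append, hgt _ _ (by omega),
      hgt _ _ (by omega), List.nil_append, List.append_nil, ← List.filter_append,
      List.filter_eq_self.2 (by simpa using hle), firstRun_append_afterRun]
  have hww : w = w' := by
    rw [← hfilter i w hw, heq, hfilter i' w' hw']
  subst hww
  refine ⟨rfl, ?_, rfl⟩
  obtain ⟨b, A, hA⟩ : ∃ b A, firstRun w = b :: A := by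
    refine List.exists_cons_of_ne_nil fun h0 => ?_
    have h1 := head?_firstRun w
    rw [h0] at h1
    have h2 : w = [] := by simpa using h1.symm
    have := hw.length_eq
    simp [h2] at this
    omega
  have hb : b ≤ h := by
    have hbw : b ∈ w := by
      rw [← firstRun_append_afterRun w, hA]
      simp
    have := List.mem_range'_1.1 (hw.mem_iff.1 hbw)
    omega
  have htake : ∀ (i : ℕ) (l : List ℕ),
      (List.range' (h + 2) i ++ b :: l).takeWhile (h < ·) = List.range' (h + 2) i := by
    intro i l
    rw [List.takeWhile_append_of_pos, List.takeWhile_cons_of_neg (by simpa using hb),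
      List.append_nil]
    intro x hx
    have := List.mem_range'_1.1 hx
    exact decide_eq_true (by omega)
  rw [hA] at heq
  simp only [List.append_assoc, List.cons_append] at heq
  have := congrArg (List.takeWhile (h < ·)) heq
  rw [htake, htake] at this
  simpa using congrArg List.length this

/-- The permutations of `1, …, n` that the `123`-machine sorts. -/
def sortedWords (n : ℕ) : Finset (List ℕ) :=
  insert (List.range' 1 n)
    (((Finset.Icc 1 (n - 1)).sigma fun h => Finset.range (n - h) ×ˢ avoiders213 h).image
      fun x => sortedWord n x.1 x.2.1 x.2.2)

/-- The inserted identity stands for h = 0, where i leaves no trace; all other words start with h +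
1 ≥ 2, so the union is disjoint. -/
theorem card_sortedWords (n : ℕ) :
    (sortedWords n).card = 1 + ∑ h ∈ Finset.Icc 1 (n - 1), (n - h) * catalan h := by
  rw [sortedWords, Finset.card_insert_of_notMem, Finset.card_image_of_injOn, Finset.card_sigma,
    Nat.add_comm]
  · simp [Finset.card_product, card_avoiders213]
  · rintro ⟨h, i, w⟩ hx ⟨h', i', w'⟩ hx' heq
    simp only [Finset.coe_sigma, Set.mem_sigma_iff, Finset.mem_coe, Finset.mem_Icc,
      Finset.mem_product] at hx hx'
    obtain ⟨rfl, rfl, rfl⟩ := sortedWord_injOn hx.1.1 (mem_avoiders213.1 hx.2.2).1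
      (mem_avoiders213.1 hx'.2.2).1 heq
    rfl
  · simp only [Finset.mem_image, Finset.mem_sigma, Finset.mem_Icc]
    rintro ⟨⟨h, i, w⟩, ⟨hh, -⟩, heq⟩
    have := congrArg List.head? heq
    rcases n with _ | n
    · simp [sortedWord] at this
    · simp only [sortedWord, List.range'_succ, List.head?_cons, Option.some.injEq] at this hh
      omega

theorem mem_sortedWords_iff {n : ℕ} (hn : 1 ≤ n) {w : List ℕ} :
    w ∈ sortedWords n ↔ w.Perm (List.range' 1 n) ∧ Avoids231 (sigmaPass w []) := by
  simp only [sortedWords, Finset.mem_insert, Finset.mem_image, Finset.mem_sigma,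
    Finset.mem_Icc, Finset.mem_product, Finset.mem_range]
  constructor
  · rintro (rfl | ⟨⟨h, i, w⟩, ⟨hh, hi, hw⟩, rfl⟩)
    · refine ⟨List.Perm.refl _, ?_⟩
      obtain ⟨n, rfl⟩ := Nat.exists_eq_add_of_le' hn
      -- The identity has k = 1 and no small letters; all the rest may be put into the first block.
      have : IsSortedTail 1 (List.range' 2 n) [] [] [] := by
        refine ⟨by simpa using List.pairwise_lt_range', ?_, by simp, by simp, .nil, by simp⟩
        intro x hx
        have := List.mem_range'_1.1 (by simpa using hx)
        omega
      simpa [List.range'_succ] using avoids231_sigmaPass_of_isSortedTail this (by simp)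
    · have hp := (mem_avoiders213.1 hw).1
      have hi' : i < n - h := hi
      refine ⟨sortedWord_perm (h := h) (i := i) (by omega) hp, ?_⟩
      refine avoids231_sigmaPass_of_isSortedTail (isSortedTail_of_mem_avoiders213 hw) ?_
      rw [firstRun_append_afterRun]
      exact hp.nodup_iff.2 List.nodup_range'
  · rintro ⟨hp, hav⟩
    have hnd : w.Nodup := hp.nodup_iff.2 List.nodup_range'
    rcases w with _ | ⟨k, v⟩
    · have := hp.length_eq
      simp at this
      omega
    obtain ⟨L₁, A, L₂, R, rfl, ht⟩ := exists_isSortedTail hnd hav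
    have hk := List.mem_range'_1.1 (hp.mem_iff.1 (List.mem_cons_self))
    obtain ⟨h, rfl⟩ := Nat.exists_eq_add_of_le' hk.1
    have hsplit : List.range' 1 n =
        List.range' 1 h ++ (h + 1) :: List.range' (h + 2) (n - 1 - h) := by
      rw [← range'_eq_append_cons]
      congr 1
      omega
    have hlarge := ht.lt_of_mem_large
    have hsmall := ht.lt_of_mem_small
    simp only [List.mem_append] at hlarge hsmall
    have hpL : (L₁ ++ L₂).Perm (List.range' (h + 2) (n - 1 - h)) := by
      have hf := hp.filter (h + 1 < ·)
      have e₁ : ((h + 1) :: (L₁ ++ A ++ L₂ ++ R)).filter (h + 1 < ·) = L₁ ++ L₂ := by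
        have h₁ : L₁.filter (h + 1 < ·) = L₁ := List.filter_eq_self.2 fun x hx => by
          simpa using hlarge x (Or.inl hx)
        have h₂ : L₂.filter (h + 1 < ·) = L₂ := List.filter_eq_self.2 fun x hx => by
          simpa using hlarge x (Or.inr hx)
        have h₃ : A.filter (h + 1 < ·) = [] := List.filter_eq_nil_iff.2 fun x hx => by
          simpa using (hsmall x (Or.inl hx)).le
        have h₄ : R.filter (h + 1 < ·) = [] := List.filter_eq_nil_iff.2 fun x hx => by
          simpa using (hsmall x (Or.inr hx)).le
        rw [List.filter_cons_of_neg (by simp)]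
        simp only [List.filter_append, h₁, h₂, h₃, h₄, List.append_nil]
      have e₂ : (List.range' 1 n).filter (h + 1 < ·) = List.range' (h + 2) (n - 1 - h) := by
        rw [hsplit, List.filter_append, List.filter_cons_of_neg (by simp),
          List.filter_eq_nil_iff.2, List.nil_append, List.filter_eq_self.2]
        · intro x hx
          have := List.mem_range'_1.1 hx
          exact decide_eq_true (by omega)
        · intro x hx
          have := List.mem_range'_1.1 hx
          simp only [decide_eq_true_eq]
          omega
      rwa [e₁, e₂] at hf
    have hpS : (A ++ R).Perm (List.range' 1 h) := by
      have hcons := hp.trans (hsplit ▸ List.perm_middle)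
      have hrest : (L₁ ++ A ++ L₂ ++ R).Perm ((L₁ ++ L₂) ++ (A ++ R)) := by
        rw [List.perm_iff_count]
        intro x
        simp only [List.count_append]
        omega
      have h₁ := hrest.symm.trans hcons.cons_inv
      have h₂ := h₁.trans (List.perm_append_comm.trans (hpL.symm.append_right _))
      exact (List.perm_append_left_iff _).1 h₂
    -- An increasing arrangement of an interval is unique, so only the position of the cut is free.
    have hL : L₁ ++ L₂ = List.range' (h + 2) (n - 1 - h) :=
      hpL.eq_of_pairwise (fun a b _ _ h₁ h₂ => absurd h₁ (by omega)) ht.pairwise_large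
        List.pairwise_lt_range'
    have hlen : L₁.length + L₂.length = n - 1 - h := by simpa using hpL.length_eq
    rcases Nat.eq_zero_or_pos h with rfl | hh
    · left
      obtain ⟨rfl, rfl⟩ : A = [] ∧ R = [] := by simpa using hpS
      rw [hsplit, ← hL]
      simp
    · right
      refine ⟨⟨h, L₁.length, A ++ R⟩, ⟨⟨hh, by dsimp only; omega⟩, by dsimp only; omega,
        mem_avoiders213.2 ⟨hpS, ht.avoids213⟩⟩, ?_⟩
      have hrun := firstRun_append ht.pairwise_run ht.exists_lt
      have hafter : afterRun (A ++ R) = R := by simp [afterRun, hrun]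
      rw [← hlen, ← List.range'_append_1] at hL
      obtain ⟨e₁, e₂⟩ := List.append_inj hL (by simp)
      have e₃ : n - 1 - h - L₁.length = L₂.length := by omega
      simp only [sortedWord, hrun, hafter, e₃, ← e₁, ← e₂]

/-! ### From words back to permutations -/

theorem word_injective (n : ℕ) : Function.Injective (word (n := n)) := by
  intro π π' h
  ext i
  have := congrFun (List.ofFn_injective h) i
  simpa using this

theorem exists_word_eq_iff {n : ℕ} {w : List ℕ} :
    (∃ π : Equiv.Perm (Fin n), word π = w) ↔ w.Perm (List.range' 1 n) := by
  constructor
  · rintro ⟨π, rfl⟩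
    have hnd : (word π).Nodup := by
      rw [word, List.nodup_ofFn]
      intro i j hij
      simpa [Fin.val_inj] using hij
    rw [List.perm_ext_iff_of_nodup hnd List.nodup_range']
    intro a
    rw [word, List.mem_ofFn, List.mem_range'_1]
    constructor
    · rintro ⟨i, rfl⟩
      have := (π i).2
      omega
    · rintro ⟨h₁, h₂⟩
      refine ⟨π.symm ⟨a - 1, by omega⟩, ?_⟩
      simp
      omega
  · intro hp
    have hlen : w.length = n := by simpa using hp.length_eq
    subst hlen
    have hnd : w.Nodup := hp.nodup_iff.2 List.nodup_range'
    have hmem : ∀ i : Fin w.length, 1 ≤ w[i] ∧ w[i] < 1 + w.length := fun i =>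
      List.mem_range'_1.1 (hp.mem_iff.1 (List.getElem_mem i.2))
    let f : Fin w.length → Fin w.length := fun i => ⟨w[i] - 1, by have := hmem i; omega⟩
    have hf : Function.Injective f := by
      intro i j hij
      have h₁ : w[i] - 1 = w[j] - 1 := congrArg Fin.val hij
      have h₂ := hmem i
      have h₃ := hmem j
      exact Fin.ext ((hnd.getElem_inj_iff (hi := i.2) (hj := j.2)).1
        (show w[i] = w[j] by omega))
    refine ⟨Equiv.ofBijective f (Finite.injective_iff_bijective.1 hf), ?_⟩
    refine List.ext_getElem (by simp [word]) fun i h₁ h₂ => ?_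
    have := hmem ⟨i, h₂⟩
    simp only [Fin.getElem_fin] at this
    simp [word, f]
    omega

theorem image_word_sortSet {n : ℕ} (hn : 1 ≤ n) :
    word '' SortSet n [1, 2, 3] = (sortedWords n : Set (List ℕ)) := by
  ext w
  rw [Finset.mem_coe, mem_sortedWords_iff hn, ← exists_word_eq_iff]
  constructor
  · rintro ⟨π, hπ, rfl⟩
    exact ⟨⟨π, rfl⟩, (machine_eq_range'_iff (exists_word_eq_iff.1 ⟨π, rfl⟩)).1 hπ⟩
  · rintro ⟨⟨π, rfl⟩, h⟩
    exact ⟨π, (machine_eq_range'_iff (exists_word_eq_iff.1 ⟨π, rfl⟩)).2 h, rfl⟩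

end SigmaMachine

theorem theorem5 (n : ℕ) (hn : 1 ≤ n) :
    (SigmaMachine.SortSet n [1, 2, 3]).ncard =
      1 + ∑ h ∈ Finset.Icc 1 (n - 1), (n - h) * catalan h := by
  rw [← Set.ncard_image_of_injective _ (SigmaMachine.word_injective n),
    SigmaMachine.image_word_sortSet hn, Set.ncard_coe_finset, SigmaMachine.card_sortedWords]
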